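/- Let $(x_i)_{i\in\mathbb Z}$ be i.i.d. standard normal random variables, let $c\in(0,1]$, and let $n=n(p)$ be positive integers with $n\ge p$ and $p/n\to c$ as $p\to\infty$. Let $\mathbf X$ be either the $p\times n$ Toeplitz matrix $\mathbf X=(x_{j-i})_{1\le i\le p,\,1\le j\le n}$ or the $p\times n$ rectangular circulant matrix $\mathbf X=(x_{(j-i)\bmod n})_{1\le i\le p,\,1\le j\le n}$ (residues in $\{0,\dots,n-1\}$), and let $\lambda_p$ denote the smallest eigenvalue of $\mathbf S=\frac1n\mathbf X\mathbf X^\top$. Then there is a constant $\beta>0$, depending only on $c$, such that in both cases $$\lambda_p=o_{\mathrm P}\left(\exp\{-\beta\log^{1/3}p\}\right)\qquad(p\to\infty),$$ that is, $\Pr\left(\lambda_p>\varepsilon\exp\{-\beta\log^{1/3}p\}\right)\to0$ for every $\varepsilon>0$. Consequently, in both cases $\lambda_p=o_{\mathrm P}(\log^{-\alpha}p)$ for every $\alpha>0$. -/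

import Mathlib

open MeasureTheory ProbabilityTheory Filter Topology

/-- The rectangular `p × n` Toeplitz matrix built from a doubly infinite sequence:
(with rows and columns numbered from `0`) the `(i, j)` entry is `x_{j-i}`. -/
def toeplitzMatrix (x : ℤ → ℝ) (p n : ℕ) : Matrix (Fin p) (Fin n) ℝ :=
  Matrix.of fun i j => x ((j : ℤ) - (i : ℤ))

/-- The rectangular `p × n` circulant matrix: the `(i, j)` entry is `x_{(j-i) mod n}`,
where the residue is taken in `{0, …, n-1}`. -/
def circulantMatrix (x : ℤ → ℝ) (p n : ℕ) : Matrix (Fin p) (Fin n) ℝ :=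
  Matrix.of fun i j => x (((j : ℤ) - (i : ℤ)) % (n : ℤ))

/-- The `p × p` matrix `S = X Xᵀ / n` of a `p × n` matrix `X`. -/
noncomputable def sampleCov {p n : ℕ} (X : Matrix (Fin p) (Fin n) ℝ) :
    Matrix (Fin p) (Fin p) ℝ :=
  (n : ℝ)⁻¹ • (X * X.transpose)

/-- The smallest real eigenvalue of a square real matrix. It is used for symmetric matrices,
whose spectrum is a finite set of real numbers, non-empty as soon as `p ≥ 1`, so that
the infimum is a minimum. -/
noncomputable def smallestEigenvalue {p : ℕ} (A : Matrix (Fin p) (Fin p) ℝ) : ℝ :=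
  sInf (spectrum ℝ A)

/-- `Y_p = o_P(r_p)` as `p → ∞`: for every `ε > 0`, the probability of `|Y_p| > ε |r_p|`
tends to `0`. -/
def IsLittleOInProbability {Ω : Type*} [MeasurableSpace Ω] (P : Measure Ω)
    (Y : ℕ → Ω → ℝ) (r : ℕ → ℝ) : Prop :=
  ∀ ε : ℝ, 0 < ε → Tendsto (fun p => P {ω | ε * |r p| < |Y p ω|}) atTop (𝓝 0)

/-!
The random sequence is viewed on a cyclic group `ZMod N`, where the matrix becomes a cyclic
convolution: `N = n` in the circulant case, and `N = n + p - 1` in the Toeplitz case, the Toeplitz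
matrix being a set of columns of a circulant one. If `ŷ` is the discrete Fourier transform of the
random sequence, then by Parseval's identity the Rayleigh quotient of `X * Xᵀ` at a vector `v` is at
most the average of `‖ŷ‖ ^ 2` against the weight `‖v̂‖ ^ 2`. So the smallest eigenvalue is small once
`ŷ` is small on a window of frequencies on which some `v` supported in `{0, …, p - 1}` concentrates
(`smallestEigenvalue_le_of_small_window`).

Such a `v` is the `m`-fold convolution of an interval of length about `p / m`, modulated to the
centre of the window (`testVector`). Its Fourier transform is the `m`-th power of a geometric sum,
which is smaller than at its peak by a factor `exp (-m)` outside a window of length of order `m`.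

The real and imaginary parts of `ŷ` at the frequencies in `(0, N / 2)` are independent Gaussian
variables of variance `N / 2`, since the real characters are orthogonal. A given window of length
of order `m` has `‖ŷ‖ ^ 2 ≤ ε ^ 2 * N` with probability at least `(ε / 4) ^ O(m)`, and there are
about `N / m` disjoint windows (`measureReal_no_small_window_le`). At all other frequencies,
`‖ŷ‖ ^ 2 ≤ 8 N log N` with high probability
(`measureReal_exists_large_cyclicFourier_le`).

Put `L = (log p) ^ (1 / 3)` and take `m` close to `L` and `ε = exp (-L)`. A window is good with
probability at least `exp (-O(L ^ 2))`, which is much larger than `m / p`, so that with high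
probability a good window exists; it gives the bound `exp (-2 L)` up to a power of `L`. Hence
`β = 1` works, and the logarithmic rates follow, as `exp (-L)` is smaller than any power of `1 / L`.
-/

/-! ### The Rayleigh bound for the smallest eigenvalue -/

theorem sampleCov_posSemidef {p n : ℕ} (X : Matrix (Fin p) (Fin n) ℝ) :
    (sampleCov X).PosSemidef := by
  have h := Matrix.posSemidef_self_mul_conjTranspose X
  rw [Matrix.conjTranspose_eq_transpose_of_trivial] at h
  exact h.smul (by positivity)

theorem spectrum_nonneg_of_posSemidef {p : ℕ} {A : Matrix (Fin p) (Fin p) ℝ}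
    (hA : A.PosSemidef) {t : ℝ} (ht : t ∈ spectrum ℝ A) : 0 ≤ t := by
  rw [hA.1.spectrum_real_eq_range_eigenvalues] at ht
  obtain ⟨i, rfl⟩ := ht
  exact hA.eigenvalues_nonneg i

theorem smallestEigenvalue_nonneg {p : ℕ} {A : Matrix (Fin p) (Fin p) ℝ}
    (hA : A.PosSemidef) : 0 ≤ smallestEigenvalue A :=
  Real.sInf_nonneg fun _ ht => spectrum_nonneg_of_posSemidef hA ht

theorem smallestEigenvalue_mul_dotProduct_le {p : ℕ} {A : Matrix (Fin p) (Fin p) ℝ}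
    (hA : A.PosSemidef) (u : Fin p → ℝ) :
    smallestEigenvalue A * (u ⬝ᵥ u) ≤ u ⬝ᵥ (A.mulVec u) := by
  set t := smallestEigenvalue A with ht
  have hH : (A - t • (1 : Matrix (Fin p) (Fin p) ℝ)).IsHermitian := by
    refine hA.1.sub ?_
    rw [Matrix.IsHermitian, Matrix.conjTranspose_smul]; simp
  have hP : (A - t • (1 : Matrix (Fin p) (Fin p) ℝ)).PosSemidef := by
    rw [hH.posSemidef_iff_eigenvalues_nonneg]
    intro i
    have hi : hH.eigenvalues i ∈ spectrum ℝ (A - t • (1 : Matrix (Fin p) (Fin p) ℝ)) := by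
      rw [hH.spectrum_real_eq_range_eigenvalues]; exact ⟨i, rfl⟩
    generalize hH.eigenvalues i = r at hi ⊢
    have hi' : r + t ∈ spectrum ℝ A := by
      rw [← Algebra.algebraMap_eq_smul_one] at hi
      have := (spectrum.add_mem_add_iff (s := t)).2 hi
      rwa [add_sub_cancel] at this
    have := csInf_le ⟨0, fun s hs => spectrum_nonneg_of_posSemidef hA hs⟩ hi'
    simp only [Pi.zero_apply]
    change t ≤ _ at this
    linarith
  have h := hP.dotProduct_mulVec_nonneg u
  simp only [star_trivial, Matrix.sub_mulVec, Matrix.smul_mulVec, Matrix.one_mulVec,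
    dotProduct_sub, dotProduct_smul, smul_eq_mul] at h
  linarith

theorem dotProduct_sampleCov {p n : ℕ} (X : Matrix (Fin p) (Fin n) ℝ) (u : Fin p → ℝ) :
    u ⬝ᵥ ((sampleCov X).mulVec u) = (n : ℝ)⁻¹ * ∑ j, (∑ i, X i j * u i) ^ 2 := by
  rw [sampleCov, Matrix.smul_mulVec, dotProduct_smul, smul_eq_mul, ← Matrix.mulVec_mulVec,
    Matrix.dotProduct_mulVec, ← Matrix.mulVec_transpose]
  congr 1
  simp [dotProduct, Matrix.mulVec, pow_two]

/-- The Rayleigh bound with complex test vectors, obtained by adding the real bounds for the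
real and the imaginary part. -/
theorem smallestEigenvalue_sampleCov_mul_le {p n : ℕ} (X : Matrix (Fin p) (Fin n) ℝ)
    (v : Fin p → ℂ) :
    smallestEigenvalue (sampleCov X) * ∑ i, ‖v i‖ ^ 2 ≤
      (n : ℝ)⁻¹ * ∑ j, ‖∑ i, (X i j : ℂ) * v i‖ ^ 2 := by
  have h1 := smallestEigenvalue_mul_dotProduct_le (sampleCov_posSemidef X) fun i => (v i).re
  have h2 := smallestEigenvalue_mul_dotProduct_le (sampleCov_posSemidef X) fun i => (v i).im
  rw [dotProduct_sampleCov] at h1 h2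
  have e1 : ∑ i, ‖v i‖ ^ 2 = (fun i => (v i).re) ⬝ᵥ (fun i => (v i).re) +
      (fun i => (v i).im) ⬝ᵥ (fun i => (v i).im) := by
    simp only [dotProduct, ← Finset.sum_add_distrib, Complex.sq_norm, Complex.normSq_apply]
  have e2 : ∑ j, ‖∑ i, (X i j : ℂ) * v i‖ ^ 2 =
      ∑ j, (∑ i, X i j * (v i).re) ^ 2 + ∑ j, (∑ i, X i j * (v i).im) ^ 2 := by
    rw [← Finset.sum_add_distrib]
    refine Finset.sum_congr rfl fun j _ => ?_
    rw [Complex.sq_norm, Complex.normSq_apply]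
    simp [Complex.re_sum, Complex.im_sum, pow_two]
  rw [e1, e2, mul_add, mul_add]
  linarith

/-! ### Fourier analysis on the cyclic group -/

open ZMod (stdAddChar)

/-- The discrete Fourier transform, at the frequency `k`, of the sequence taking the value
`v i` at the position `φ i` of the cyclic group and vanishing elsewhere. -/
noncomputable def cyclicFourier {N : ℕ} [NeZero N] {ι : Type*} [Fintype ι] (φ : ι → ZMod N)
    (v : ι → ℂ) (k : ZMod N) : ℂ :=
  ∑ i, v i * stdAddChar (φ i * k)

section
variable {N : ℕ} [NeZero N]

theorem conj_stdAddChar (a : ZMod N) :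
    (starRingEnd ℂ) (stdAddChar a) = stdAddChar (-a) :=
  (AddChar.map_neg_eq_conj _ _).symm

theorem sum_stdAddChar_mul (b : ZMod N) :
    ∑ k : ZMod N, stdAddChar (b * k) = if b = 0 then (N : ℂ) else 0 := by
  have := AddChar.sum_mulShift b (ZMod.isPrimitive_stdAddChar N)
  simp only [mul_comm _ b, ZMod.card] at this
  rw [this]; split_ifs <;> simp

/-- **Parseval's identity**. -/
theorem sum_norm_cyclicFourier_sq {ι : Type*} [Fintype ι] {φ : ι → ZMod N}
    (hφ : Function.Injective φ) (v : ι → ℂ) :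
    ∑ k, ‖cyclicFourier φ v k‖ ^ 2 = N * ∑ i, ‖v i‖ ^ 2 := by
  classical
  have key : ((∑ k, ‖cyclicFourier φ v k‖ ^ 2 : ℝ) : ℂ) = ((N * ∑ i, ‖v i‖ ^ 2 : ℝ) : ℂ) := by
    push_cast
    simp only [← Complex.mul_conj', cyclicFourier, map_sum, map_mul, conj_stdAddChar]
    simp only [Finset.sum_mul_sum]
    rw [Finset.sum_comm, Finset.mul_sum]
    refine Finset.sum_congr rfl fun i _ => ?_
    rw [Finset.sum_comm, Finset.sum_eq_single i]
    · have : ∀ k : ZMod N, v i * stdAddChar (φ i * k) *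
          ((starRingEnd ℂ) (v i) * stdAddChar (-(φ i * k))) =
          v i * (starRingEnd ℂ) (v i) := fun k => by
        rw [mul_mul_mul_comm, ← AddChar.map_add_eq_mul, add_neg_cancel, AddChar.map_zero_eq_one,
          mul_one]
      simp [this]
    · intro j _ hj
      have : ∀ k : ZMod N, v i * stdAddChar (φ i * k) *
          ((starRingEnd ℂ) (v j) * stdAddChar (-(φ j * k))) =
          v i * (starRingEnd ℂ) (v j) * stdAddChar ((φ i - φ j) * k) := fun k => by
        rw [mul_mul_mul_comm, ← AddChar.map_add_eq_mul]; ring_nf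
      simp only [this, ← Finset.mul_sum, sum_stdAddChar_mul]
      rw [if_neg (sub_ne_zero.2 fun h => hj (hφ h.symm)), mul_zero]
    · simp
  exact_mod_cast key

/-- The Fourier transform turns cyclic convolution into multiplication. -/
theorem cyclicFourier_convolution {ι : Type*} [Fintype ι] (φ : ι → ZMod N) (v : ι → ℂ)
    (y : ZMod N → ℂ) (k : ZMod N) :
    cyclicFourier id (fun r => ∑ i, y (r - φ i) * v i) k =
      cyclicFourier id y k * cyclicFourier φ v k := by
  simp only [cyclicFourier, id, Finset.sum_mul]
  rw [Finset.sum_comm]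
  simp only [Finset.mul_sum]
  conv_rhs => rw [Finset.sum_comm]
  refine Finset.sum_congr rfl fun i _ => ?_
  rw [← Equiv.sum_comp (Equiv.addRight (φ i))]
  refine Finset.sum_congr rfl fun r _ => ?_
  rw [Equiv.coe_addRight, add_sub_cancel_right, add_mul, AddChar.map_add_eq_mul]
  ring

/-- The lower bound for the chord `|e(d) - 1|` coming from Jordan's inequality for the sine. -/
theorem le_norm_stdAddChar_sub_one (d : ZMod N) :
    4 * |(d.valMinAbs : ℝ)| / N ≤ ‖stdAddChar d - 1‖ := by
  have hN : (0 : ℝ) < N := by exact_mod_cast NeZero.pos N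
  set t : ℤ := d.valMinAbs with ht
  have hd : stdAddChar d = Complex.exp (Complex.I * (2 * Real.pi * t / N : ℝ)) := by
    rw [← ZMod.coe_valMinAbs d, ZMod.stdAddChar_coe, ← ht]
    push_cast; ring_nf
  rw [hd, Complex.norm_exp_I_mul_ofReal_sub_one, norm_mul, Real.norm_eq_abs, Real.norm_eq_abs]
  have ht2 : |(t : ℝ)| ≤ N / 2 := by
    have h := ZMod.valMinAbs_mem_Ioc d
    rw [← ht] at h
    have h1 : (-(N : ℝ)) < t * 2 := by exact_mod_cast h.1
    have h2 : (t : ℝ) * 2 ≤ N := by exact_mod_cast h.2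
    rw [abs_le]; constructor <;> linarith
  have habs : |Real.sin (2 * Real.pi * t / N / 2)| = |Real.sin (Real.pi * |(t : ℝ)| / N)| := by
    rcases abs_cases (t : ℝ) with h | h <;> rw [h.1]
    · ring_nf
    · rw [← abs_neg, ← Real.sin_neg]; ring_nf
  rw [habs, abs_two]
  have hx : Real.pi * |(t : ℝ)| / N ≤ Real.pi / 2 := by
    rw [div_le_div_iff₀ hN two_pos]; nlinarith [Real.pi_pos]
  have := Real.mul_le_sin (x := Real.pi * |(t : ℝ)| / N) (by positivity) hx
  calc 4 * |(t : ℝ)| / N = 2 * (2 / Real.pi * (Real.pi * |(t : ℝ)| / N)) := by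
        field_simp; ring
    _ ≤ 2 * |Real.sin (Real.pi * |(t : ℝ)| / N)| := by
        gcongr; exact this.trans (le_abs_self _)
end

/-! ### Test vectors concentrated in time and in frequency -/

/-- The polynomial `(1 + z + ⋯ + z ^ (q - 1)) ^ m`. Its coefficients are those of the `m`-fold
convolution of the indicator function of an interval of length `q`. -/
noncomputable def boxPower (q m : ℕ) : Polynomial ℂ :=
  (∑ j ∈ Finset.range q, Polynomial.X ^ j) ^ m

theorem eval_boxPower (q m : ℕ) (z : ℂ) :
    (boxPower q m).eval z = (∑ j ∈ Finset.range q, z ^ j) ^ m := by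
  simp [boxPower, Polynomial.eval_finsetSum]

theorem natDegree_boxPower_lt {q m p : ℕ} (h : m * (q - 1) < p) :
    (boxPower q m).natDegree < p := by
  refine lt_of_le_of_lt (Polynomial.natDegree_pow_le.trans ?_) h
  refine Nat.mul_le_mul_left _ (Polynomial.natDegree_sum_le_of_forall_le _ _ fun j hj => ?_)
  rw [Polynomial.natDegree_X_pow]
  have := Finset.mem_range.1 hj
  omega

/-- The coefficients of `boxPower q m`, modulated to the frequency `k₀`. -/
noncomputable def testVector {N : ℕ} [NeZero N] (p q m : ℕ) (k₀ : ZMod N) (i : Fin p) : ℂ :=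
  (boxPower q m).coeff i * stdAddChar (-(((i : ℕ) : ZMod N) * k₀))

section
variable {N : ℕ} [NeZero N]

omit [NeZero N] in
theorem injective_natCast_fin {p : ℕ} (hp : p ≤ N) :
    Function.Injective fun i : Fin p => ((i : ℕ) : ZMod N) := by
  intro i j h
  have h' := (ZMod.natCast_eq_natCast_iff' _ _ _).1 h
  rw [Nat.mod_eq_of_lt (i.2.trans_le hp), Nat.mod_eq_of_lt (j.2.trans_le hp)] at h'
  exact Fin.ext h'

theorem cyclicFourier_testVector {p q m : ℕ} (h : m * (q - 1) < p) (k₀ k : ZMod N) :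
    cyclicFourier (fun i : Fin p => ((i : ℕ) : ZMod N)) (testVector p q m k₀) k =
      (∑ j ∈ Finset.range q, stdAddChar (k - k₀) ^ j) ^ m := by
  rw [← eval_boxPower, Polynomial.eval_eq_sum_range' (natDegree_boxPower_lt h),
    Finset.sum_range]
  refine Finset.sum_congr rfl fun i _ => ?_
  rw [testVector, mul_assoc, ← AddChar.map_add_eq_mul, ← AddChar.map_nsmul_eq_pow, nsmul_eq_mul]
  ring_nf

/-- By the Cauchy–Schwarz inequality, the mass of the test vector is at least that of the
constant vector with the same sum of coefficients. -/
theorem le_sum_norm_testVector_sq {p q m : ℕ} (h : m * (q - 1) < p) (k₀ : ZMod N) :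
    (q : ℝ) ^ (2 * m) ≤ p * ∑ i, ‖testVector p q m k₀ i‖ ^ 2 := by
  have h1 := cyclicFourier_testVector h k₀ k₀
  rw [sub_self, AddChar.map_zero_eq_one] at h1
  have h2 : (q : ℝ) ^ m ≤ ∑ i, ‖testVector p q m k₀ i‖ := by
    calc (q : ℝ) ^ m = ‖cyclicFourier (fun i : Fin p => ((i : ℕ) : ZMod N))
          (testVector p q m k₀) k₀‖ := by rw [h1]; simp
      _ ≤ _ := (norm_sum_le _ _).trans_eq (by simp)
  calc (q : ℝ) ^ (2 * m) = ((q : ℝ) ^ m) ^ 2 := by ring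
    _ ≤ (∑ i, ‖testVector p q m k₀ i‖) ^ 2 := by gcongr
    _ ≤ _ := by simpa using sq_sum_le_card_mul_sum_sq (s := Finset.univ)
                  (f := fun i : Fin p => ‖testVector p q m k₀ i‖)

theorem norm_geom_sum_stdAddChar_le {q K : ℕ} (hK : 0 < K) {d : ZMod N}
    (hd : (K : ℝ) < |(d.valMinAbs : ℝ)|) :
    ‖∑ j ∈ Finset.range q, (stdAddChar d : ℂ) ^ j‖ ≤ N / (2 * K) := by
  have hN : (0 : ℝ) < N := by exact_mod_cast NeZero.pos N
  have hK' : (0 : ℝ) < K := by exact_mod_cast hK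
  have h1 : 4 * (K : ℝ) / N ≤ ‖(stdAddChar d : ℂ) - 1‖ :=
    le_trans (by gcongr) (le_norm_stdAddChar_sub_one d)
  have h2 := congrArg norm (geom_sum_mul (stdAddChar d : ℂ) q)
  rw [norm_mul] at h2
  have h3 : ‖(stdAddChar d : ℂ) ^ q - 1‖ ≤ 2 := by
    refine (norm_sub_le _ _).trans ?_
    simp; norm_num
  have h4 : ‖∑ j ∈ Finset.range q, (stdAddChar d : ℂ) ^ j‖ * (4 * (K : ℝ) / N) ≤ 2 :=
    le_trans (by gcongr) (h2.le.trans h3)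
  rw [le_div_iff₀ (by positivity)]
  have : ‖∑ j ∈ Finset.range q, (stdAddChar d : ℂ) ^ j‖ * (4 * (K : ℝ)) ≤ 2 * N := by
    rwa [mul_div_assoc', div_le_iff₀ hN] at h4
  linarith

theorem sum_norm_geom_sum_sq {q : ℕ} (hq : q ≤ N) :
    ∑ d : ZMod N, ‖∑ j ∈ Finset.range q, (stdAddChar d : ℂ) ^ j‖ ^ 2 = N * q := by
  have := sum_norm_cyclicFourier_sq (injective_natCast_fin hq) (fun _ => (1 : ℂ))
  simp only [cyclicFourier, one_mul, norm_one, one_pow, Finset.sum_const, Finset.card_univ,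
    Fintype.card_fin, nsmul_eq_mul, mul_one] at this
  rw [← this]
  refine Finset.sum_congr rfl fun d _ => ?_
  rw [Finset.sum_range]
  simp only [← nsmul_eq_mul, AddChar.map_nsmul_eq_pow]

/-- The energy of the test vector at distance more than `K` from its central frequency:
all but one of the `s + 1` factors are bounded pointwise, the remaining one in mean square. -/
theorem sum_far_norm_le {q K s : ℕ} (hq : q ≤ N) (hK : 0 < K) :
    ∑ d : ZMod N with (K : ℝ) < |(d.valMinAbs : ℝ)|,
      ‖(∑ j ∈ Finset.range q, (stdAddChar d : ℂ) ^ j) ^ (s + 1)‖ ^ 2 ≤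
      (N / (2 * K) : ℝ) ^ (2 * s) * (N * q) := by
  rw [← sum_norm_geom_sum_sq hq, Finset.mul_sum]
  refine (Finset.sum_le_sum fun d hd => ?_).trans
    (Finset.sum_le_sum_of_subset_of_nonneg (Finset.filter_subset _ _) fun _ _ _ => by positivity)
  have := norm_geom_sum_stdAddChar_le (q := q) hK (Finset.mem_filter.1 hd).2
  rw [norm_pow, ← pow_mul, add_mul, one_mul, pow_add, mul_comm s 2]
  gcongr

/-- The energy of the output is computed on the whole cyclic group, of which the columns of the
matrix only see the part `σ`. -/
theorem sum_norm_mul_le {p n : ℕ} {σ : Fin n → ZMod N}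
    (hσ : Function.Injective σ) (y : ZMod N → ℝ) (v : Fin p → ℂ) :
    N * ∑ j, ‖∑ i : Fin p, (y (σ j - (i : ℕ)) : ℂ) * v i‖ ^ 2 ≤
      ∑ k, ‖cyclicFourier id (fun r => (y r : ℂ)) k‖ ^ 2 *
        ‖cyclicFourier (fun i : Fin p => ((i : ℕ) : ZMod N)) v k‖ ^ 2 := by
  have h := sum_norm_cyclicFourier_sq (N := N) Function.injective_id
    (fun r => ∑ i : Fin p, (y (r - (i : ℕ)) : ℂ) * v i)
  have h2 := fun k => cyclicFourier_convolution (fun i : Fin p => ((i : ℕ) : ZMod N)) v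
    (fun r => (y r : ℂ)) k
  simp only [h2, norm_mul, mul_pow] at h
  rw [h]
  gcongr
  rw [← Finset.sum_image (f := fun r => ‖∑ i : Fin p, (y (r - (i : ℕ)) : ℂ) * v i‖ ^ 2)
    (s := Finset.univ) (g := σ) hσ.injOn]
  exact Finset.sum_le_sum_of_subset_of_nonneg (Finset.subset_univ _) fun _ _ _ => by positivity

/-- If the Fourier transform of `y` is small at all frequencies within `K` of `k₀`, and not too
large anywhere, then the smallest eigenvalue is small: test with the vector concentrated
at the frequency `k₀`. -/
theorem smallestEigenvalue_le_of_small_window {p n q s K : ℕ} (hp : p ≤ N) (hn : 0 < n)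
    (hq : 0 < q) (hqN : q ≤ N) (hK : 0 < K) (hqs : (s + 1) * (q - 1) < p)
    {σ : Fin n → ZMod N} (hσ : Function.Injective σ) (y : ZMod N → ℝ)
    {X : Matrix (Fin p) (Fin n) ℝ} (hX : ∀ i j, X i j = y (σ j - (i : ℕ)))
    {ε M : ℝ} (k₀ : ZMod N)
    (hsmall : ∀ d : ZMod N, |(d.valMinAbs : ℝ)| ≤ K →
      ‖cyclicFourier id (fun r => (y r : ℂ)) (k₀ + d)‖ ^ 2 ≤ ε ^ 2 * N)
    (hlarge : ∀ k, ‖cyclicFourier id (fun r => (y r : ℂ)) k‖ ^ 2 ≤ M * N)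
    (hρ : (N : ℝ) / (2 * K * q) ≤ Real.exp (-1)) :
    smallestEigenvalue (sampleCov X) ≤
      N / n * (ε ^ 2 + M * (p / q) * Real.exp (-(2 * s))) := by
  have hN : (0 : ℝ) < N := by exact_mod_cast NeZero.pos N
  have hn' : (0 : ℝ) < n := by exact_mod_cast hn
  have hq' : (0 : ℝ) < q := by exact_mod_cast hq
  have hK' : (0 : ℝ) < K := by exact_mod_cast hK
  have hp' : (0 : ℝ) < p := by exact_mod_cast (Nat.zero_le _).trans_lt hqs
  have hM : 0 ≤ M := by
    have := (sq_nonneg _).trans (hlarge 0)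
    exact nonneg_of_mul_nonneg_left this hN
  set v := testVector p q (s + 1) k₀ with hv
  set V := ∑ i, ‖v i‖ ^ 2 with hV
  have hVlow : (q : ℝ) ^ (2 * (s + 1)) ≤ p * V := le_sum_norm_testVector_sq hqs k₀
  have hVpos : 0 < V := by
    have : 0 < (p : ℝ) * V := lt_of_lt_of_le (by positivity) hVlow
    exact pos_of_mul_pos_right this hp'.le
  set g : ZMod N → ℂ := fun d => (∑ j ∈ Finset.range q, (stdAddChar d : ℂ) ^ j) ^ (s + 1) with hg
  have hpars : ∑ d, ‖g d‖ ^ 2 = N * V := by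
    rw [hV, ← sum_norm_cyclicFourier_sq (injective_natCast_fin hp) v,
      ← Equiv.sum_comp (Equiv.subRight k₀)]
    refine Finset.sum_congr rfl fun k _ => ?_
    rw [hv, cyclicFourier_testVector hqs]; rfl
  have hout : N * ∑ j, ‖∑ i, (X i j : ℂ) * v i‖ ^ 2 ≤
      ε ^ 2 * N * (N * V) + M * N * ((N / (2 * K) : ℝ) ^ (2 * s) * (N * q)) := by
    simp only [hX]
    refine (sum_norm_mul_le hσ y v).trans ?_
    rw [← Equiv.sum_comp (Equiv.addLeft k₀)]
    simp only [hv, cyclicFourier_testVector hqs, Equiv.coe_addLeft, add_sub_cancel_left]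
    rw [← Finset.sum_filter_add_sum_filter_not _
      (fun d : ZMod N => (K : ℝ) < |(d.valMinAbs : ℝ)|), add_comm]
    gcongr ?_ + ?_
    · rw [← hpars, Finset.mul_sum]
      refine (Finset.sum_le_sum fun d hd => ?_).trans
        (Finset.sum_le_sum_of_subset_of_nonneg (Finset.filter_subset _ _)
          fun _ _ _ => by positivity)
      exact mul_le_mul_of_nonneg_right
        (hsmall d (not_lt.1 (Finset.mem_filter.1 hd).2)) (by positivity)
    · refine le_trans (Finset.sum_le_sum fun d _ => ?_)
        ((Finset.mul_sum _ _ _).symm.trans_le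
          (mul_le_mul_of_nonneg_left (sum_far_norm_le hqN hK) (by positivity)))
      exact mul_le_mul_of_nonneg_right (hlarge _) (by positivity)
  have hray := smallestEigenvalue_sampleCov_mul_le X v
  rw [← hV] at hray
  have htail : (N / (2 * K) : ℝ) ^ (2 * s) * q ≤ (p / q) * Real.exp (-(2 * s)) * V := by
    have e1 : (N / (2 * K) : ℝ) ^ (2 * s) = (N / (2 * K * q) : ℝ) ^ (2 * s) * q ^ (2 * s) := by
      rw [← mul_pow]; congr 1; field_simp
    have e2 : Real.exp (-(2 * s)) = Real.exp (-1) ^ (2 * s) := by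
      rw [← Real.exp_nat_mul]; push_cast; ring_nf
    rw [e1, e2]
    calc (N / (2 * K * q) : ℝ) ^ (2 * s) * q ^ (2 * s) * q
        ≤ Real.exp (-1) ^ (2 * s) * q ^ (2 * s) * q := by gcongr
      _ = Real.exp (-1) ^ (2 * s) * (q ^ (2 * (s + 1)) / q) := by
        field_simp; ring
      _ ≤ Real.exp (-1) ^ (2 * s) * (p * V / q) := by gcongr
      _ = _ := by ring
  refine le_of_mul_le_mul_right (hray.trans ?_) hVpos
  have hout' : ∑ j, ‖∑ i, (X i j : ℂ) * v i‖ ^ 2 ≤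
      N * (ε ^ 2 + M * (p / q) * Real.exp (-(2 * s))) * V := by
    refine le_of_mul_le_mul_left (hout.trans ?_) hN
    have := mul_le_mul_of_nonneg_left htail (by positivity : 0 ≤ M * N * N)
    nlinarith [this]
  calc _ ≤ (n : ℝ)⁻¹ * (N * (ε ^ 2 + M * (p / q) * Real.exp (-(2 * s))) * V) := by gcongr
    _ = _ := by ring
end

/-! ### Linear combinations of independent Gaussian variables -/

section
variable {Ω : Type*} [MeasurableSpace Ω] {P : Measure Ω} [IsProbabilityMeasure P]
  {ι : Type*} [Fintype ι] {f : ι → Ω → ℝ}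

theorem covariance_linearCombination (hf : ∀ i, HasLaw (f i) (gaussianReal 0 1) P)
    (hind : iIndepFun f P) (u v : ι → ℝ) :
    cov[fun ω => ∑ i, u i * f i ω, fun ω => ∑ i, v i * f i ω; P] = ∑ i, u i * v i := by
  have hmem : ∀ i, MemLp (f i) 2 P := fun i => (hf i).hasGaussianLaw.memLp_two
  rw [covariance_fun_sum_fun_sum (fun i => (hmem i).const_mul _) (fun i => (hmem i).const_mul _)]
  refine Finset.sum_congr rfl fun i _ => ?_
  rw [Finset.sum_eq_single i]
  · rw [covariance_const_mul_left, covariance_const_mul_right,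
      covariance_self (hf i).aemeasurable, (hf i).variance_eq, variance_id_gaussianReal]
    simp
  · intro j _ hj
    rw [covariance_const_mul_left, covariance_const_mul_right,
      (hind.indepFun hj.symm).covariance_eq_zero (hmem i) (hmem j)]
    simp
  · simp

omit [IsProbabilityMeasure P] in
theorem hasGaussianLaw_linearCombination (hf : ∀ i, HasLaw (f i) (gaussianReal 0 1) P)
    (hind : iIndepFun f P) {α τ : Type*} [Fintype α] [Fintype τ] (u : α → τ → ι → ℝ) :
    HasGaussianLaw (fun ω a t => ∑ i, u a t i * f i ω) P := by
  have h := hind.hasGaussianLaw fun i => (hf i).hasGaussianLaw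
  have := h.map_fun (ContinuousLinearMap.pi fun a => ContinuousLinearMap.pi fun t =>
    ∑ i, u a t i • (ContinuousLinearMap.proj i : (ι → ℝ) →L[ℝ] ℝ))
  simpa [sum_apply] using! this

theorem hasLaw_linearCombination (hf : ∀ i, HasLaw (f i) (gaussianReal 0 1) P)
    (hind : iIndepFun f P) (u : ι → ℝ) :
    HasLaw (fun ω => ∑ i, u i * f i ω) (gaussianReal 0 (∑ i, u i ^ 2).toNNReal) P := by
  have hG : HasGaussianLaw (fun ω => ∑ i, u i * f i ω) P :=
    ((hasGaussianLaw_linearCombination hf hind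
      (fun (_ : Unit) (_ : Unit) => u)).eval ()).eval ()
  refine ⟨hG.aemeasurable, ?_⟩
  rw [hG.map_eq_gaussianReal]
  congr 1
  · rw [integral_finsetSum _ fun i _ => ((hf i).hasGaussianLaw.integrable).const_mul _]
    refine Finset.sum_eq_zero fun i _ => ?_
    rw [integral_const_mul, (hf i).integral_eq, integral_id_gaussianReal, mul_zero]
  · rw [← covariance_self hG.aemeasurable, covariance_linearCombination hf hind]
    simp only [pow_two]

theorem measureReal_linearCombination_ge (hf : ∀ i, HasLaw (f i) (gaussianReal 0 1) P)
    (hind : iIndepFun f P) (u : ι → ℝ) {c : ℝ} (hc : 0 ≤ c) (hu : ∑ i, u i ^ 2 ≤ c)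
    {t : ℝ} (ht : 0 ≤ t) :
    P.real {ω | t ≤ ∑ i, u i * f i ω} ≤ Real.exp (-t ^ 2 / (2 * c)) := by
  have hlaw := hasLaw_linearCombination hf hind u
  have hsub : HasSubgaussianMGF (fun ω => ∑ i, u i * f i ω) c.toNNReal P := by
    refine ⟨fun s => ?_, fun s => ?_⟩
    · have := integrable_exp_mul_gaussianReal (μ := 0) (v := (∑ i, u i ^ 2).toNNReal) s
      rw [← hlaw.map_eq, integrable_map_measure (by fun_prop) hlaw.aemeasurable] at this
      exact this
    · rw [mgf_gaussianReal hlaw.map_eq, Real.coe_toNNReal _ hc,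
        Real.coe_toNNReal _ (Finset.sum_nonneg fun _ _ => sq_nonneg _), zero_mul, zero_add]
      gcongr
  have := hsub.measure_ge_le ht
  rwa [Real.coe_toNNReal _ hc] at this

theorem measureReal_sq_linearCombination_ge (hf : ∀ i, HasLaw (f i) (gaussianReal 0 1) P)
    (hind : iIndepFun f P) (u : ι → ℝ) {c : ℝ} (hc : 0 ≤ c) (hu : ∑ i, u i ^ 2 ≤ c)
    {a : ℝ} (ha : 0 ≤ a) :
    P.real {ω | a ≤ (∑ i, u i * f i ω) ^ 2} ≤ 2 * Real.exp (-a / (2 * c)) := by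
  have h1 := measureReal_linearCombination_ge hf hind u hc hu (Real.sqrt_nonneg a)
  have h2 := measureReal_linearCombination_ge hf hind (fun i => -u i) hc (by simpa using hu)
    (Real.sqrt_nonneg a)
  rw [Real.sq_sqrt ha] at h1 h2
  have hsub : {ω | a ≤ (∑ i, u i * f i ω) ^ 2} ⊆ {ω | √a ≤ ∑ i, u i * f i ω} ∪
      {ω | √a ≤ ∑ i, -u i * f i ω} := by
    intro ω hω
    have := Real.sqrt_le_sqrt hω
    rw [Real.sqrt_sq_eq_abs, le_abs] at this
    simpa [Finset.sum_neg_distrib] using this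
  calc _ ≤ _ := measureReal_mono hsub
    _ ≤ _ := measureReal_union_le _ _
    _ ≤ _ := by linarith

theorem le_gaussianReal_Icc {ε : ℝ} (h0 : 0 ≤ ε) (h1 : ε ≤ 1) :
    ε / 4 ≤ (gaussianReal 0 1).real (Set.Icc (-ε) ε) := by
  have hpdf : ∀ x ∈ Set.Icc (-ε) ε, ENNReal.ofReal (1 / 8) ≤ gaussianPDF 0 1 x := by
    intro x hx
    refine ENNReal.ofReal_le_ofReal ?_
    have hx2 : x ^ 2 ≤ 1 := by nlinarith [hx.1, hx.2]
    have he : (1 / 2 : ℝ) ≤ Real.exp (-x ^ 2 / 2) := by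
      have := Real.add_one_le_exp (-x ^ 2 / 2)
      linarith
    have hs : √(2 * Real.pi) ≤ 4 := by
      rw [Real.sqrt_le_left (by norm_num)]; nlinarith [Real.pi_lt_d2]
    have hs0 : 0 < √(2 * Real.pi) := by positivity
    have hs' : (1 / 4 : ℝ) ≤ (√(2 * Real.pi))⁻¹ := by
      rw [one_div]; exact inv_anti₀ hs0 hs
    simp only [gaussianPDFReal, NNReal.coe_one, mul_one, sub_zero]
    nlinarith
  have h : ENNReal.ofReal (ε / 4) ≤ gaussianReal 0 1 (Set.Icc (-ε) ε) := by
    rw [gaussianReal_apply _ one_ne_zero]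
    refine le_trans ?_ (setLIntegral_mono (measurable_gaussianPDF 0 1) hpdf)
    rw [setLIntegral_const, Real.volume_Icc, ← ENNReal.ofReal_mul (by norm_num)]
    exact ENNReal.ofReal_le_ofReal (by linarith)
  exact (ENNReal.ofReal_le_iff_le_toReal (measure_ne_top _ _)).1 h

/-- Small-ball estimate: among `|α|` independent blocks, each made of `|τ|` independent standard
Gaussian variables, one is likely to be small in all its coordinates. The variables are
given as orthonormal linear combinations of independent standard Gaussian variables. -/
theorem measureReal_no_small_block_le (hf : ∀ i, HasLaw (f i) (gaussianReal 0 1) P)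
    (hind : iIndepFun f P) {α τ : Type*} [Fintype α] [Fintype τ] [DecidableEq α]
    [DecidableEq τ] {u : α → τ → ι → ℝ}
    (hu : ∀ a t a' t', ∑ i, u a t i * u a' t' i = if a = a' ∧ t = t' then 1 else 0)
    {ε : ℝ} (h0 : 0 ≤ ε) (h1 : ε ≤ 1) :
    P.real {ω | ∀ a, ∃ t, ε < |∑ i, u a t i * f i ω|} ≤
      Real.exp (-(Fintype.card α * (ε / 4) ^ Fintype.card τ)) := by
  set G : α → τ → Ω → ℝ := fun a t ω => ∑ i, u a t i * f i ω with hG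
  have hgauss : HasGaussianLaw (fun ω a t => G a t ω) P :=
    hasGaussianLaw_linearCombination hf hind u
  have hlaw : ∀ a t, HasLaw (G a t) (gaussianReal 0 1) P := fun a t => by
    have := hasLaw_linearCombination hf hind (u a t)
    simpa [pow_two, hu] using this
  have hblocks : iIndepFun (fun a ω t => G a t ω) P :=
    hgauss.iIndepFun_of_covariance_eval fun a a' haa' t t' => by
      rw [hG, covariance_linearCombination hf hind, hu, if_neg (fun h => haa' h.1)]
  have hinner : ∀ a, iIndepFun (G a) P := fun a =>
    (hgauss.eval a).iIndepFun_of_covariance_eq_zero fun t t' htt' => by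
      rw [hG, covariance_linearCombination hf hind, hu, if_neg (fun h => htt' h.2)]
  set B : Set (τ → ℝ) := Set.univ.pi fun _ => Set.Icc (-ε) ε with hB
  have hmemB : ∀ x, x ∈ B ↔ ∀ t, |x t| ≤ ε := fun x => by
    simp only [hB, Set.mem_univ_pi, Set.mem_Icc, abs_le]
  have hBm : MeasurableSet B := MeasurableSet.univ_pi fun _ => measurableSet_Icc
  have hPB : ∀ a, (ε / 4) ^ Fintype.card τ ≤ P.real ((fun ω t => G a t ω) ⁻¹' B) := by
    intro a
    have e : (fun ω t => G a t ω) ⁻¹' B = ⋂ t ∈ Finset.univ, G a t ⁻¹' Set.Icc (-ε) ε := by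
      ext ω; simp [hmemB, abs_le]
    rw [e, measureReal_def, (hinner a).measure_inter_preimage_eq_mul _
      (fun _ _ => measurableSet_Icc), ENNReal.toReal_prod]
    calc (ε / 4) ^ Fintype.card τ = ∏ _t : τ, ε / 4 := by rw [Finset.prod_const, Finset.card_univ]
      _ ≤ _ := Finset.prod_le_prod (fun _ _ => by positivity) fun t _ => ?_
    refine (le_gaussianReal_Icc h0 h1).trans_eq ?_
    rw [← (hlaw a t).map_eq, measureReal_def,
      Measure.map_apply_of_aemeasurable (hlaw a t).aemeasurable measurableSet_Icc]
  have e : {ω | ∀ a, ∃ t, ε < |∑ i, u a t i * f i ω|} =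
      ⋂ a ∈ Finset.univ, (fun ω t => G a t ω) ⁻¹' Bᶜ := by
    ext ω; simp [hmemB, hG]
  rw [e, measureReal_def, hblocks.measure_inter_preimage_eq_mul _ (fun _ _ => hBm.compl),
    ENNReal.toReal_prod]
  calc ∏ a, (P ((fun ω t => G a t ω) ⁻¹' Bᶜ)).toReal
      ≤ ∏ _a : α, Real.exp (-((ε / 4) ^ Fintype.card τ)) := by
        refine Finset.prod_le_prod (fun _ _ => ENNReal.toReal_nonneg) fun a _ => ?_
        have hm : AEMeasurable (fun ω t => G a t ω) P :=
          aemeasurable_pi_lambda _ fun t => (hlaw a t).aemeasurable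
        rw [Set.preimage_compl, ← measureReal_def,
          probReal_compl_eq_one_sub₀ (hm.nullMeasurableSet_preimage hBm)]
        have := Real.add_one_le_exp (-((ε / 4) ^ Fintype.card τ))
        linarith [hPB a]
    _ = _ := by
        rw [Finset.prod_const, Finset.card_univ, ← Real.exp_nat_mul]
        congr 1; ring
end

/-! ### The Fourier coefficients of Gaussian noise -/

section
variable {N : ℕ} [NeZero N]

/-- The real (`b = true`) or imaginary (`b = false`) part of the character of frequency `k`. -/
noncomputable def realCharacter (k : ZMod N) (b : Bool) (r : ZMod N) : ℝ :=
  if b then (stdAddChar (r * k) : ℂ).re else (stdAddChar (r * k) : ℂ).im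

theorem norm_stdAddChar (a : ZMod N) : ‖(stdAddChar a : ℂ)‖ = 1 := by simp

theorem sum_realCharacter_sq_le (k : ZMod N) (b : Bool) :
    ∑ r, realCharacter k b r ^ 2 ≤ N := by
  have h : ∀ r : ZMod N, realCharacter k b r ^ 2 ≤ 1 := fun r => by
    rw [sq_le_one_iff_abs_le_one]
    cases b
    · exact (Complex.abs_im_le_norm _).trans_eq (norm_stdAddChar _)
    · exact (Complex.abs_re_le_norm _).trans_eq (norm_stdAddChar _)
  calc _ ≤ ∑ _r : ZMod N, (1 : ℝ) := Finset.sum_le_sum fun r _ => h r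
    _ = _ := by simp

theorem norm_cyclicFourier_sq (y : ZMod N → ℝ) (k : ZMod N) :
    ‖cyclicFourier id (fun r => (y r : ℂ)) k‖ ^ 2 =
      (∑ r, realCharacter k true r * y r) ^ 2 + (∑ r, realCharacter k false r * y r) ^ 2 := by
  rw [Complex.sq_norm, Complex.normSq_apply]
  simp [cyclicFourier, realCharacter, Complex.re_sum, Complex.im_sum, pow_two, mul_comm]

/-- Distinct frequencies in the open interval `(0, N / 2)` have orthogonal real characters. -/
theorem sum_realCharacter_mul {k l : ℕ} (hk : 0 < k) (hkN : 2 * k < N) (hlN : 2 * l < N)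
    (b b' : Bool) :
    ∑ r : ZMod N, realCharacter (k : ZMod N) b r * realCharacter (l : ZMod N) b' r =
      if k = l ∧ b = b' then (N : ℝ) / 2 else 0 := by
  have hplus : ((k : ZMod N) + l) ≠ 0 := by
    rw [← Nat.cast_add, Ne, ZMod.natCast_eq_zero_iff]
    intro h; have := Nat.le_of_dvd (by omega) h; omega
  have hminus : ((k : ZMod N) - l) = 0 ↔ k = l := by
    rw [sub_eq_zero, ZMod.natCast_eq_natCast_iff', Nat.mod_eq_of_lt (by omega),
      Nat.mod_eq_of_lt (by omega)]
  have hP : ∑ r : ZMod N, stdAddChar (r * (k : ZMod N)) * stdAddChar (r * (l : ZMod N)) = 0 := by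
    have := sum_stdAddChar_mul ((k : ZMod N) + (l : ZMod N))
    rw [if_neg hplus] at this
    rw [← this]
    refine Finset.sum_congr rfl fun r _ => ?_
    rw [← AddChar.map_add_eq_mul]; ring_nf
  have hM : ∑ r : ZMod N, stdAddChar (r * (k : ZMod N)) *
      (starRingEnd ℂ) (stdAddChar (r * (l : ZMod N))) =
      ((if k = l then (N : ℝ) else 0 : ℝ) : ℂ) := by
    have := sum_stdAddChar_mul ((k : ZMod N) - (l : ZMod N))
    simp only [hminus] at this
    rw [show ((if k = l then (N : ℝ) else 0 : ℝ) : ℂ) = if k = l then (N : ℂ) else 0 by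
      split_ifs <;> simp, ← this]
    refine Finset.sum_congr rfl fun r _ => ?_
    rw [conj_stdAddChar, ← AddChar.map_add_eq_mul]; ring_nf
  have p1 := congrArg Complex.re hP
  have p2 := congrArg Complex.im hP
  have m1 := congrArg Complex.re hM
  have m2 := congrArg Complex.im hM
  simp only [Complex.re_sum, Complex.im_sum, Complex.mul_re, Complex.mul_im, Complex.conj_re,
    Complex.conj_im, Complex.ofReal_re, Complex.ofReal_im, Complex.zero_re, Complex.zero_im,
    Finset.sum_add_distrib, Finset.sum_sub_distrib, mul_neg, sub_neg_eq_add,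
    Finset.sum_neg_distrib] at p1 p2 m1 m2
  by_cases hkl : k = l
  · cases b <;> cases b' <;> simp [realCharacter, hkl] at * <;> linarith
  · cases b <;> cases b' <;> simp [realCharacter, hkl] at * <;> linarith

variable {Ω : Type*} [MeasurableSpace Ω] {P : Measure Ω} [IsProbabilityMeasure P]
  {f : ZMod N → Ω → ℝ}

theorem measureReal_exists_large_cyclicFourier_le
    (hf : ∀ i, HasLaw (f i) (gaussianReal 0 1) P) (hind : iIndepFun f P) {M : ℝ} (hM : 0 ≤ M) :
    P.real {ω | ∃ k, M * N < ‖cyclicFourier id (fun r => (f r ω : ℂ)) k‖ ^ 2} ≤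
      4 * N * Real.exp (-M / 4) := by
  have hN : (0 : ℝ) < N := by exact_mod_cast NeZero.pos N
  have hsub : {ω | ∃ k, M * N < ‖cyclicFourier id (fun r => (f r ω : ℂ)) k‖ ^ 2} ⊆
      ⋃ kb : ZMod N × Bool,
        {ω | M * N / 2 ≤ (∑ r, realCharacter kb.1 kb.2 r * f r ω) ^ 2} := by
    rintro ω ⟨k, hk⟩
    rw [norm_cyclicFourier_sq] at hk
    by_contra! h
    simp only [Set.mem_iUnion, Set.mem_ofPred_eq, not_exists, not_le] at h
    have h1 := h (k, true)
    have h2 := h (k, false)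
    simp only at h1 h2
    linarith
  calc _ ≤ _ := measureReal_mono hsub
    _ ≤ _ := measureReal_iUnion_fintype_le _
    _ ≤ ∑ _kb : ZMod N × Bool, 2 * Real.exp (-M / 4) := by
        refine Finset.sum_le_sum fun kb _ => ?_
        refine (measureReal_sq_linearCombination_ge hf hind _ hN.le
          (sum_realCharacter_sq_le kb.1 kb.2) (by positivity)).trans_eq ?_
        congr 2; field_simp; ring
    _ = _ := by simp; ring

/-- With `W` disjoint windows of `J` consecutive frequencies each, it is unlikely that the
Fourier transform of Gaussian noise fails to be small on each of them. -/
theorem measureReal_no_small_window_le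
    (hf : ∀ i, HasLaw (f i) (gaussianReal 0 1) P) (hind : iIndepFun f P) {W J : ℕ}
    (hWJ : 2 * (W * J) < N) {ε : ℝ} (h0 : 0 ≤ ε) (h1 : ε ≤ 1) :
    P.real {ω | ∀ w < W, ∃ t < J,
      ε ^ 2 * N < ‖cyclicFourier id (fun r => (f r ω : ℂ)) ((1 + w * J + t : ℕ) : ZMod N)‖ ^ 2} ≤
      Real.exp (-(W * (ε / 4) ^ (2 * J))) := by
  have hN : (0 : ℝ) < N := by exact_mod_cast NeZero.pos N
  set κ : Fin W → Fin J → ℕ := fun w t => 1 + w * J + t with hκ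
  have hκ2 : ∀ w t, 2 * κ w t < N := fun w t => by
    have h : ((w : ℕ) + 1) * J ≤ W * J := Nat.mul_le_mul_right _ w.2
    have := t.2
    simp only [hκ]; nlinarith
  have hκinj : ∀ w t w' t', κ w t = κ w' t' ↔ w = w' ∧ t = t' := by
    intro w t w' t'
    refine ⟨fun h => ?_, by rintro ⟨rfl, rfl⟩; rfl⟩
    have hJ : 0 < J := (Nat.zero_le _).trans_lt t.2
    have h' : (t : ℕ) + J * w = t' + J * w' := by simp only [hκ] at h; linarith
    have hw := congrArg (· / J) h'
    simp only [Nat.add_mul_div_left _ _ hJ, Nat.div_eq_of_lt t.2, Nat.div_eq_of_lt t'.2,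
      zero_add] at hw
    rw [hw] at h'
    exact ⟨Fin.ext hw, Fin.ext (by omega)⟩
  set u : Fin W → Fin J × Bool → ZMod N → ℝ :=
    fun w tb r => √(2 / N) * realCharacter (κ w tb.1 : ZMod N) tb.2 r with hu
  have hsq : √(2 / (N : ℝ)) * √(2 / N) = 2 / N := Real.mul_self_sqrt (by positivity)
  have horth : ∀ a t a' t', ∑ i, u a t i * u a' t' i = if a = a' ∧ t = t' then 1 else 0 := by
    intro w t w' t'
    have : ∀ i, u w t i * u w' t' i = 2 / N * (realCharacter (κ w t.1 : ZMod N) t.2 i *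
        realCharacter (κ w' t'.1 : ZMod N) t'.2 i) := fun i => by
      rw [← hsq]; simp only [hu]; ring
    simp only [this, ← Finset.mul_sum]
    rw [sum_realCharacter_mul (by simp only [hκ]; omega) (hκ2 _ _) (hκ2 _ _),
      mul_ite, mul_zero, div_mul_div_cancel₀ hN.ne', div_self two_ne_zero]
    exact if_congr (by rw [hκinj, Prod.ext_iff, and_assoc]) rfl rfl
  have h := measureReal_no_small_block_le hf hind horth h0 h1
  rw [Fintype.card_prod, Fintype.card_fin, Fintype.card_fin, Fintype.card_bool,
    mul_comm J] at h
  refine (measureReal_mono ?_).trans h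
  intro ω hω w
  obtain ⟨t, ht, hlt⟩ := hω w w.2
  by_contra! hall
  have hb : ∀ b, (∑ r, realCharacter ((1 + w * J + t : ℕ) : ZMod N) b r * f r ω) ^ 2 ≤
      ε ^ 2 * N / 2 := by
    intro b
    have h2 := hall (⟨t, ht⟩, b)
    simp only [hu, mul_assoc, ← Finset.mul_sum, hκ] at h2
    have h3 := pow_le_pow_left₀ (abs_nonneg _) h2 2
    rw [sq_abs, mul_pow, Real.sq_sqrt (by positivity), div_mul_eq_mul_div, div_le_iff₀ hN] at h3
    linarith
  rw [norm_cyclicFourier_sq] at hlt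
  linarith [hb true, hb false]
end

/-! ### The tail bound for matrices of fixed size -/

section
variable {Ω : Type*} [MeasurableSpace Ω] {P : Measure Ω} [IsProbabilityMeasure P]

/-- The probabilistic bound at fixed parameters: outside the two exceptional events, some window
of `2 * K + 1` frequencies around a `k₀` satisfies the hypotheses of
`smallestEigenvalue_le_of_small_window`. -/
theorem measureReal_lt_smallestEigenvalue_le {N : ℕ} [NeZero N] {f : ZMod N → Ω → ℝ}
    (hf : ∀ i, HasLaw (f i) (gaussianReal 0 1) P) (hind : iIndepFun f P)
    {p n q s K W : ℕ} (hp : p ≤ N) (hn : 0 < n)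
    (hq : 0 < q) (hqN : q ≤ N) (hK : 0 < K) (hqs : (s + 1) * (q - 1) < p)
    (hW : 2 * (W * (2 * K + 1)) < N)
    {σ : Fin n → ZMod N} (hσ : Function.Injective σ)
    {X : Ω → Matrix (Fin p) (Fin n) ℝ} (hX : ∀ ω i j, X ω i j = f (σ j - (i : ℕ)) ω)
    {ε M : ℝ} (h0 : 0 ≤ ε) (h1 : ε ≤ 1) (hM : 0 ≤ M)
    (hρ : (N : ℝ) / (2 * K * q) ≤ Real.exp (-1)) :
    P.real {ω | N / n * (ε ^ 2 + M * (p / q) * Real.exp (-(2 * s))) <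
        smallestEigenvalue (sampleCov (X ω))} ≤
      4 * N * Real.exp (-M / 4) + Real.exp (-(W * (ε / 4) ^ (2 * (2 * K + 1)))) := by
  refine le_trans ?_ (add_le_add (measureReal_exists_large_cyclicFourier_le hf hind hM)
    (measureReal_no_small_window_le hf hind hW h0 h1))
  refine le_trans (measureReal_mono ?_) (measureReal_union_le _ _)
  intro ω hω
  by_contra hbad
  rw [Set.mem_union, not_or] at hbad
  obtain ⟨hlarge, hsmall⟩ := hbad
  simp only [Set.mem_ofPred_eq, not_exists, not_lt, not_forall, not_and] at hlarge hsmall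
  obtain ⟨w, -, hw⟩ := hsmall
  rw [Set.mem_ofPred_eq, ← not_le] at hω
  refine hω ?_
  refine smallestEigenvalue_le_of_small_window hp hn hq hqN hK hqs hσ (fun r => f r ω)
    (hX ω) ((1 + w * (2 * K + 1) + K : ℕ) : ZMod N) (fun d hd => ?_) hlarge hρ
  have hd' : |d.valMinAbs| ≤ (K : ℤ) := by exact_mod_cast hd
  rw [abs_le] at hd'
  have ht : (((K : ℤ) + d.valMinAbs).toNat : ℤ) = K + d.valMinAbs := Int.toNat_of_nonneg (by omega)
  have := hw ((K : ℤ) + d.valMinAbs).toNat (by omega)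
  have hc := congrArg (Int.cast : ℤ → ZMod N) ht
  push_cast [ZMod.coe_valMinAbs] at hc
  rwa [Nat.cast_add, hc, ← add_assoc, ← Nat.cast_add] at this

/-- A lower bound for the expected number of good windows of length `J` of order `L`: as
`log p = L ^ 3`, the factor `p` beats the probability `exp (-O(L ^ 2))` of a single window. -/
theorem exp_le_expected_small_windows {p N C J W : ℕ} {L : ℝ} (hp0 : 0 < p) (hp : p ≤ N)
    (hL : 0 ≤ L) (hLp : L ^ 3 = Real.log p) (hJ : 0 < J) (hJL : (J : ℝ) ≤ 7 * C * (L + 2))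
    (hNW : (N : ℝ) / (4 * J) - 1 ≤ W) :
    Real.exp (L ^ 3 - 14 * C * (L + 2) * (L + 4)) - 1 ≤
      W * (Real.exp (-L) / 4) ^ (2 * J) := by
  have hp' : (0 : ℝ) < p := by exact_mod_cast hp0
  have hJ0 : (0 : ℝ) < J := by exact_mod_cast hJ
  have hε : Real.exp (-(L + 2)) ≤ Real.exp (-L) / 4 := by
    have h4 : (4 : ℝ) ≤ Real.exp 2 := by
      rw [show (2 : ℝ) = 1 + 1 by norm_num, Real.exp_add]
      nlinarith [Real.exp_one_gt_d9]
    rw [neg_add, Real.exp_add, div_eq_mul_inv]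
    gcongr
    rw [Real.exp_neg]
    exact inv_anti₀ (by norm_num) h4
  have h4J : (4 * J : ℝ) ≤ Real.exp (4 * J) := by linarith [Real.add_one_le_exp (4 * (J : ℝ))]
  have hpow1 : (Real.exp (-L) / 4) ^ (2 * J) ≤ 1 := by
    refine pow_le_one₀ (by positivity) ?_
    linarith [Real.exp_le_one_iff.2 (by linarith : -L ≤ 0)]
  have hmain : Real.exp (L ^ 3 - 14 * C * (L + 2) * (L + 4)) ≤
      N / (4 * J) * (Real.exp (-L) / 4) ^ (2 * J) := by
    calc Real.exp (L ^ 3 - 14 * C * (L + 2) * (L + 4))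
        ≤ Real.exp (L ^ 3 - 4 * J + (2 * J : ℕ) * (-(L + 2))) := by
          refine Real.exp_le_exp.2 ?_
          push_cast
          nlinarith [mul_le_mul_of_nonneg_right hJL (by linarith : 0 ≤ 2 * (L + 4))]
      _ = p / Real.exp (4 * J) * Real.exp (-(L + 2)) ^ (2 * J) := by
          rw [Real.exp_add, Real.exp_sub, hLp, Real.exp_log hp', Real.exp_nat_mul]
      _ ≤ _ := by gcongr
  have := mul_le_mul_of_nonneg_right hNW
    (by positivity : 0 ≤ (Real.exp (-L) / 4) ^ (2 * J))
  rw [sub_mul, one_mul] at this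
  linarith

/-- The previous bound with the parameters adapted to the scale `L = (log p) ^ (1 / 3)`: the
test vector has about `L` factors, the windows have length of order `L`, and the Fourier
coefficients in the good window have relative size `exp (-L)`. -/
theorem measureReal_lt_smallestEigenvalue_le_of_log {N : ℕ} [NeZero N] {f : ZMod N → Ω → ℝ}
    (hf : ∀ i, HasLaw (f i) (gaussianReal 0 1) P) (hind : iIndepFun f P)
    {p n C : ℕ} (hp : p ≤ N) (hn : 0 < n) (hp0 : 0 < p) (hC : 0 < C) (hNC : N ≤ C * p)
    (hNn : N ≤ 2 * n)
    {σ : Fin n → ZMod N} (hσ : Function.Injective σ)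
    {X : Ω → Matrix (Fin p) (Fin n) ℝ} (hX : ∀ ω i j, X ω i j = f (σ j - (i : ℕ)) ω)
    {L δ : ℝ} (hL : 0 ≤ L) (hLp : L ^ 3 = Real.log p) (hLp2 : L + 2 ≤ p)
    (hδ : 2 * (1 + 16 * (L + 2) * (Real.log C + L ^ 3)) * Real.exp (-L) ≤ δ) :
    P.real {ω | δ * Real.exp (-L) < smallestEigenvalue (sampleCov (X ω))} ≤
      4 / p + Real.exp (1 - Real.exp (L ^ 3 - 14 * C * (L + 2) * (L + 4))) := by
  have hN : (0 : ℝ) < N := by exact_mod_cast NeZero.pos N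
  have hn' : (0 : ℝ) < n := by exact_mod_cast hn
  have hp' : (0 : ℝ) < p := by exact_mod_cast hp0
  have hC' : (1 : ℝ) ≤ C := by exact_mod_cast hC
  set s := ⌈L⌉₊ with hs
  have hsL : L ≤ s := Nat.le_ceil L
  have hsL' : (s : ℝ) + 1 ≤ L + 2 := by linarith [Nat.ceil_lt_add_one hL]
  have hmp : s + 1 ≤ p := by exact_mod_cast hsL'.trans hLp2
  set q := p / (s + 1) with hqdef
  have hq : 0 < q := Nat.div_pos hmp (by omega)
  have hqp : (s + 1) * q ≤ p := Nat.mul_div_le p (s + 1)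
  have hpq : p < (s + 1) * (q + 1) := by
    rw [mul_comm]; exact Nat.lt_mul_of_div_lt (Nat.lt_succ_self _) (by omega)
  have hpq2 : (p : ℝ) ≤ 2 * (s + 1) * q := by
    have : p ≤ 2 * (s + 1) * q := by nlinarith
    exact_mod_cast this
  have hqs : (s + 1) * (q - 1) < p :=
    lt_of_lt_of_le (Nat.mul_lt_mul_of_pos_left (by omega) (by omega)) hqp
  have hq' : (0 : ℝ) < q := by exact_mod_cast hq
  -- The factor `3 > e` makes the geometric sum at least `e` times smaller than its peak `q`
  -- outside the window.
  set K := 3 * C * (s + 1) with hKdef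
  have hK : 0 < K := by positivity
  set J := 2 * K + 1 with hJ
  -- The windows have to stay below the frequency `N / 2`, beyond which the coefficients are the
  -- conjugates of earlier ones.
  set W := N / (4 * J) with hWdef
  have hWN : 4 * J * W ≤ N := Nat.mul_div_le N (4 * J)
  have hW : 2 * (W * J) < N := by
    have := NeZero.pos N
    nlinarith
  have hNW : (N : ℝ) / (4 * J) - 1 ≤ W := by
    have : N < 4 * J * (W + 1) := by
      rw [mul_comm]; exact Nat.lt_mul_of_div_lt (Nat.lt_succ_self _) (by omega)
    have h' : (N : ℝ) < 4 * J * (W + 1) := by exact_mod_cast this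
    rw [sub_le_iff_le_add, div_le_iff₀ (by positivity)]
    linarith
  have hN1 : (1 : ℝ) ≤ N := by exact_mod_cast NeZero.pos N
  have hlogN : 0 ≤ Real.log N := Real.log_nonneg hN1
  have hNCr : (N : ℝ) ≤ C * p := by exact_mod_cast hNC
  have hlogNC : Real.log N ≤ Real.log C + L ^ 3 := by
    rw [hLp, ← Real.log_mul (by positivity) (by positivity)]
    exact Real.log_le_log hN hNCr
  have hρ : (N : ℝ) / (2 * K * q) ≤ Real.exp (-1) := by
    have h3 : (1 / 3 : ℝ) ≤ Real.exp (-1) := by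
      rw [Real.exp_neg, one_div]
      exact inv_anti₀ (Real.exp_pos _) Real.exp_one_lt_three.le
    refine le_trans ?_ h3
    rw [div_le_iff₀ (by positivity)]
    have : (K : ℝ) = 3 * C * (s + 1) := by rw [hKdef]; push_cast; ring
    rw [this]
    nlinarith [mul_le_mul_of_nonneg_left hpq2 (by positivity : (0 : ℝ) ≤ C)]
  have key := measureReal_lt_smallestEigenvalue_le hf hind (ε := Real.exp (-L))
    -- With this `M`, the union bound over the `N` frequencies is `4 * N * N ^ (-2)`.
    (M := 8 * Real.log N) hp hn hq ((Nat.div_le_self _ _).trans hp) hK hqs hW hσ hX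
    (Real.exp_pos _).le (Real.exp_le_one_iff.2 (by linarith)) (by positivity) hρ
  refine (measureReal_mono fun ω hω => ?_).trans (key.trans (add_le_add ?_ ?_))
  · rw [Set.mem_ofPred_eq] at hω ⊢
    refine lt_of_le_of_lt ?_ hω
    have e1 : Real.exp (-L) ^ 2 = Real.exp (-L) * Real.exp (-L) := pow_two _
    have e2 : Real.exp (-(2 * s)) ≤ Real.exp (-L) * Real.exp (-L) := by
      rw [← Real.exp_add]; exact Real.exp_le_exp.2 (by linarith)
    have e3 : (p : ℝ) / q ≤ 2 * (L + 2) := by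
      rw [div_le_iff₀ hq']
      exact hpq2.trans (by gcongr)
    have e4 : (N : ℝ) / n ≤ 2 := by
      rw [div_le_iff₀ hn']; exact_mod_cast hNn
    calc (N : ℝ) / n * (Real.exp (-L) ^ 2 + 8 * Real.log N * (p / q) * Real.exp (-(2 * s)))
        ≤ 2 * (Real.exp (-L) * Real.exp (-L) + 8 * (Real.log C + L ^ 3) * (2 * (L + 2)) *
            (Real.exp (-L) * Real.exp (-L))) := by
          rw [e1]
          have : 0 ≤ Real.log C + L ^ 3 := hlogN.trans hlogNC
          gcongr
      _ = 2 * (1 + 16 * (L + 2) * (Real.log C + L ^ 3)) * Real.exp (-L) * Real.exp (-L) := by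
          ring
      _ ≤ _ := by gcongr
  · have : Real.exp (-(8 * Real.log N) / 4) = ((N : ℝ) * N)⁻¹ := by
      rw [show -(8 * Real.log N) / 4 = -(Real.log N + Real.log N) by ring, Real.exp_neg,
        Real.exp_add, Real.exp_log hN]
    rw [this]
    calc 4 * (N : ℝ) * ((N : ℝ) * N)⁻¹ = 4 / N := by field_simp
      _ ≤ 4 / p := by gcongr
  · rw [Real.exp_le_exp]
    have hJL : (J : ℝ) ≤ 7 * C * (L + 2) := by
      have : (J : ℝ) = 6 * C * (s + 1) + 1 := by rw [hJ, hKdef]; push_cast; ring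
      rw [this]
      have h1 : (C : ℝ) * (s + 1) ≤ C * (L + 2) := by gcongr
      have h2 : (1 : ℝ) ≤ C * (L + 2) := by nlinarith
      linarith
    have := exp_le_expected_small_windows hp0 hp hL hLp (by omega : 0 < J) hJL hNW
    linarith
end

/-! ### Asymptotics -/

section
variable {Ω : Type*} [MeasurableSpace Ω] {P : Measure Ω} [IsProbabilityMeasure P]

omit [IsProbabilityMeasure P] in
theorem IsLittleOInProbability.of_eventually_le {Y : ℕ → Ω → ℝ} {r r' : ℕ → ℝ}
    (h : IsLittleOInProbability P Y r) (hr : ∀ᶠ p in atTop, |r p| ≤ |r' p|) :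
    IsLittleOInProbability P Y r' := by
  intro ε hε
  refine tendsto_of_tendsto_of_tendsto_of_le_of_le' tendsto_const_nhds (h ε hε)
    (Eventually.of_forall fun _ => zero_le) ?_
  filter_upwards [hr] with p hp
  refine measure_mono fun ω hω => ?_
  rw [Set.mem_ofPred_eq] at hω ⊢
  exact lt_of_le_of_lt (by gcongr) hω

theorem tendsto_log_rpow_third :
    Tendsto (fun p : ℕ => Real.log (p : ℝ) ^ ((1 : ℝ) / 3)) atTop atTop :=
  (tendsto_rpow_atTop (by norm_num)).comp
    (Real.tendsto_log_atTop.comp tendsto_natCast_atTop_atTop)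

theorem log_rpow_third_pow (p : ℕ) : (Real.log (p : ℝ) ^ ((1 : ℝ) / 3)) ^ 3 = Real.log p := by
  rw [← Real.rpow_natCast, ← Real.rpow_mul (Real.log_natCast_nonneg p)]
  norm_num

theorem tendsto_cube_sub_atTop (a : ℝ) :
    Tendsto (fun x : ℝ => x ^ 3 - a * (x + 2) * (x + 4)) atTop atTop := by
  refine tendsto_atTop_mono' _ ?_ tendsto_id
  filter_upwards [eventually_ge_atTop 1, eventually_ge_atTop (15 * |a| + 1)] with x h1 h2
  have ha : a * ((x + 2) * (x + 4)) ≤ |a| * (15 * x ^ 2) :=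
    (mul_le_mul_of_nonneg_right (le_abs_self a) (by positivity)).trans
      (mul_le_mul_of_nonneg_left (by nlinarith) (abs_nonneg a))
  have := mul_le_mul_of_nonneg_right h2 (sq_nonneg x)
  simp only [id]
  nlinarith

theorem tendsto_poly_mul_exp_neg (b : ℝ) :
    Tendsto (fun x : ℝ => 2 * (1 + 16 * (x + 2) * (b + x ^ 3)) * Real.exp (-x)) atTop (𝓝 0) := by
  have hk := Real.tendsto_pow_mul_exp_neg_atTop_nhds_zero
  have h := (((hk 0).const_mul (2 + 64 * b)).add
    ((hk 1).const_mul (32 * b))).add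
    (((hk 3).const_mul 64).add ((hk 4).const_mul 32))
  simp only [mul_zero, add_zero] at h
  refine h.congr fun x => ?_
  ring

/-- The rate `exp (-(log p) ^ (1 / 3))` for any sequence of random matrices that are columns
`σ` of circulant matrices built from independent standard Gaussian variables, as long as the
size `N` of the circulant matrices is comparable with both dimensions. -/
theorem isLittleOInProbability_of_circulant_columns {n : ℕ → ℕ}
    {X : ∀ p, Ω → Matrix (Fin p) (Fin (n p)) ℝ} {C : ℕ} (hC : 0 < C)
    (hX : ∀ᶠ p in atTop, ∃ N : ℕ, p ≤ N ∧ N ≤ C * p ∧ N ≤ 2 * n p ∧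
      ∃ (f : ZMod N → Ω → ℝ) (σ : Fin (n p) → ZMod N),
        (∀ i, HasLaw (f i) (gaussianReal 0 1) P) ∧ iIndepFun f P ∧ Function.Injective σ ∧
        ∀ ω i j, X p ω i j = f (σ j - (i : ℕ)) ω) :
    IsLittleOInProbability P (fun p ω => smallestEigenvalue (sampleCov (X p ω)))
      (fun p => Real.exp (-1 * Real.log (p : ℝ) ^ ((1 : ℝ) / 3))) := by
  intro δ hδ
  set L : ℕ → ℝ := fun p => Real.log (p : ℝ) ^ ((1 : ℝ) / 3) with hL
  have hbound : Tendsto (fun p : ℕ => 4 / (p : ℝ) +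
      Real.exp (1 - Real.exp (L p ^ 3 - 14 * C * (L p + 2) * (L p + 4)))) atTop (𝓝 0) := by
    rw [← add_zero (0 : ℝ)]
    refine (tendsto_const_div_atTop_nhds_zero_nat 4).add (Real.tendsto_exp_atBot.comp ?_)
    exact tendsto_atBot_add_const_left _ 1 (tendsto_neg_atTop_atBot.comp
      (Real.tendsto_exp_atTop.comp ((tendsto_cube_sub_atTop (14 * C)).comp tendsto_log_rpow_third)))
  have hbound' := ENNReal.tendsto_ofReal hbound
  rw [ENNReal.ofReal_zero] at hbound'
  refine tendsto_of_tendsto_of_tendsto_of_le_of_le' tendsto_const_nhds hbound'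
    (Eventually.of_forall fun _ => zero_le) ?_
  have hsmall := ((tendsto_poly_mul_exp_neg (Real.log C)).comp
    tendsto_log_rpow_third).eventually (ge_mem_nhds hδ)
  filter_upwards [hX, hsmall, eventually_gt_atTop 0,
    tendsto_log_rpow_third.eventually_ge_atTop 2] with p hXp hsp hp0 hL2
  obtain ⟨N, hpN, hNC, hNn, f, σ, hf, hind, hσ, hXf⟩ := hXp
  have hN0 : NeZero N := ⟨by omega⟩
  have hLp : L p ^ 3 = Real.log p := log_rpow_third_pow p
  have hLp2 : L p + 2 ≤ p := by
    have hp' : (0 : ℝ) < p := by exact_mod_cast hp0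
    have h1 := Real.add_one_le_exp (Real.log (p : ℝ))
    rw [Real.exp_log hp', ← hLp] at h1
    have h2 : 2 ≤ L p := hL2
    nlinarith [mul_le_mul h2 h2 (by norm_num) (by linarith)]
  have key := measureReal_lt_smallestEigenvalue_le_of_log hf hind hpN (by omega) hp0 hC hNC hNn
    hσ hXf (le_trans (by norm_num) hL2) hLp hLp2 hsp
  rw [← ofReal_measureReal (measure_ne_top _ _)]
  refine ENNReal.ofReal_le_ofReal (le_trans (measureReal_mono fun ω hω => ?_) key)
  rw [Set.mem_ofPred_eq] at hω ⊢
  rw [abs_of_nonneg (smallestEigenvalue_nonneg (sampleCov_posSemidef _)),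
    abs_of_pos (Real.exp_pos _), neg_one_mul] at hω
  exact hω

theorem eventually_exp_neg_le_log_rpow {α : ℝ} :
    ∀ᶠ p : ℕ in atTop, |Real.exp (-1 * Real.log (p : ℝ) ^ ((1 : ℝ) / 3))| ≤
      |Real.log (p : ℝ) ^ (-α)| := by
  have h := ((tendsto_rpow_mul_exp_neg_mul_atTop_nhds_zero (3 * α) 1 one_pos).comp
    tendsto_log_rpow_third).eventually (ge_mem_nhds one_pos)
  filter_upwards [h, tendsto_log_rpow_third.eventually_gt_atTop 0, eventually_gt_atTop 1]
    with p hp hpos hp1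
  have hlog : 0 < Real.log (p : ℝ) := Real.log_pos (by exact_mod_cast hp1)
  have e : (Real.log (p : ℝ) ^ ((1 : ℝ) / 3)) ^ (3 * α) = Real.log p ^ α := by
    rw [← Real.rpow_mul hlog.le]; ring_nf
  simp only [Function.comp_apply, e] at hp
  rw [abs_of_pos (Real.exp_pos _), abs_of_pos (Real.rpow_pos_of_pos hlog _),
    Real.rpow_neg hlog.le, ← one_div, le_div_iff₀ (Real.rpow_pos_of_pos hlog _), mul_comm]
  exact hp

/-! ### Toeplitz and circulant matrices -/

theorem eventually_two_mul_le {c : ℝ} (hc : 0 < c) {n : ℕ → ℕ}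
    (hlim : Tendsto (fun p : ℕ => (p : ℝ) / (n p : ℝ)) atTop (𝓝 c)) :
    ∀ᶠ p in atTop, 2 * n p ≤ ⌈4 / c⌉₊ * p := by
  filter_upwards [hlim.eventually (lt_mem_nhds (half_lt_self hc))] with p hp
  rcases Nat.eq_zero_or_pos (n p) with h0 | h0
  · simp [h0]
  have hn : (0 : ℝ) < n p := by exact_mod_cast h0
  rw [lt_div_iff₀ hn] at hp
  have h1 : 2 * (n p : ℝ) ≤ 4 / c * p := by
    rw [div_mul_eq_mul_div, le_div_iff₀ hc]; linarith
  have h2 : 2 * (n p : ℝ) ≤ ⌈4 / c⌉₊ * p := h1.trans (by gcongr; exact Nat.le_ceil _)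
  exact_mod_cast h2

variable {x : ℤ → Ω → ℝ}

omit [IsProbabilityMeasure P] in
theorem exists_circulant_columns_circulantMatrix
    (hx : ∀ i, HasLaw (x i) (gaussianReal 0 1) P) (hind : iIndepFun x P) {p n : ℕ}
    (hn : 0 < n) :
    ∃ (f : ZMod n → Ω → ℝ) (σ : Fin n → ZMod n),
      (∀ i, HasLaw (f i) (gaussianReal 0 1) P) ∧ iIndepFun f P ∧ Function.Injective σ ∧
      ∀ ω (i : Fin p) j, circulantMatrix (fun k => x k ω) p n i j = f (σ j - (i : ℕ)) ω := by
  have : NeZero n := ⟨hn.ne'⟩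
  refine ⟨fun r => x (r.val : ℤ), fun j => ((j : ℕ) : ZMod n), fun _ => hx _,
    hind.precomp (g := fun r : ZMod n => (r.val : ℤ)) fun a b h =>
      ZMod.val_injective n (by beta_reduce at h; exact_mod_cast h), injective_natCast_fin le_rfl,
    fun ω i j => ?_⟩
  have := ZMod.val_intCast (n := n) ((j : ℤ) - (i : ℤ))
  push_cast at this
  simp only [circulantMatrix, Matrix.of_apply, this]

omit [IsProbabilityMeasure P] in
/-- A `p × n` Toeplitz matrix is made of the last `n` columns of a circulant matrix with
`n + p - 1` columns. -/
theorem exists_circulant_columns_toeplitzMatrix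
    (hx : ∀ i, HasLaw (x i) (gaussianReal 0 1) P) (hind : iIndepFun x P) {p n : ℕ}
    (hp : 0 < p) (hn : 0 < n) :
    ∃ (f : ZMod (n + p - 1) → Ω → ℝ) (σ : Fin n → ZMod (n + p - 1)),
      (∀ i, HasLaw (f i) (gaussianReal 0 1) P) ∧ iIndepFun f P ∧ Function.Injective σ ∧
      ∀ ω (i : Fin p) j, toeplitzMatrix (fun k => x k ω) p n i j = f (σ j - (i : ℕ)) ω := by
  have : NeZero (n + p - 1) := ⟨by omega⟩
  refine ⟨fun r => x ((r.val : ℤ) - (p - 1 : ℕ)),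
    fun j => ((j + (p - 1) : ℕ) : ZMod (n + p - 1)), fun _ => hx _,
    hind.precomp (g := fun r : ZMod (n + p - 1) => (r.val : ℤ) - (p - 1 : ℕ)) fun a b h =>
      ZMod.val_injective _ (by beta_reduce at h; omega), fun i j h => ?_, fun ω i j => ?_⟩
  · have h' := (ZMod.natCast_eq_natCast_iff' _ _ _).1 h
    rw [Nat.mod_eq_of_lt (by omega), Nat.mod_eq_of_lt (by omega)] at h'
    exact Fin.ext (by omega)
  · have hval : ((((j : ℕ) + (p - 1) : ℕ) : ZMod (n + p - 1)) - ((i : ℕ) : ZMod (n + p - 1))).val =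
        (j : ℕ) + (p - 1) - i := by
      rw [← Nat.cast_sub (by omega), ZMod.val_natCast, Nat.mod_eq_of_lt (by omega)]
    simp only [toeplitzMatrix, Matrix.of_apply, hval]
    congr 1
    omega
end

theorem theorem1 (c : ℝ) (hc0 : 0 < c) (hc1 : c ≤ 1) :
    ∃ β : ℝ, 0 < β ∧
      ∀ (Ω : Type*) [MeasurableSpace Ω] (P : Measure Ω) [IsProbabilityMeasure P]
        (x : ℤ → Ω → ℝ),
        (∀ i, HasLaw (x i) (gaussianReal 0 1) P) → iIndepFun x P →
        ∀ n : ℕ → ℕ, (∀ᶠ p in atTop, p ≤ n p) →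
          Tendsto (fun p : ℕ => (p : ℝ) / (n p : ℝ)) atTop (𝓝 c) →
          (IsLittleOInProbability P
              (fun p ω => smallestEigenvalue
                (sampleCov (toeplitzMatrix (fun i => x i ω) p (n p))))
              (fun p => Real.exp (-β * (Real.log (p : ℝ)) ^ ((1 : ℝ) / 3))) ∧
            IsLittleOInProbability P
              (fun p ω => smallestEigenvalue
                (sampleCov (circulantMatrix (fun i => x i ω) p (n p))))
              (fun p => Real.exp (-β * (Real.log (p : ℝ)) ^ ((1 : ℝ) / 3)))) ∧
          ∀ α : ℝ, 0 < α →
            IsLittleOInProbability P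
              (fun p ω => smallestEigenvalue
                (sampleCov (toeplitzMatrix (fun i => x i ω) p (n p))))
              (fun p => (Real.log (p : ℝ)) ^ (-α)) ∧
            IsLittleOInProbability P
              (fun p ω => smallestEigenvalue
                (sampleCov (circulantMatrix (fun i => x i ω) p (n p))))
              (fun p => (Real.log (p : ℝ)) ^ (-α)) := by
  refine ⟨1, one_pos, fun Ω _ P _ x hx hind n hpn hlim => ?_⟩
  have hC : 0 < ⌈4 / c⌉₊ := Nat.ceil_pos.2 (by positivity)
  have hT : IsLittleOInProbability P
      (fun p ω => smallestEigenvalue (sampleCov (toeplitzMatrix (fun i => x i ω) p (n p))))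
      (fun p => Real.exp (-1 * Real.log (p : ℝ) ^ ((1 : ℝ) / 3))) := by
    refine isLittleOInProbability_of_circulant_columns hC ?_
    filter_upwards [hpn, eventually_two_mul_le hc0 hlim, eventually_gt_atTop 0] with p h1 h2 h3
    exact ⟨n p + p - 1, by omega, by omega, by omega,
      exists_circulant_columns_toeplitzMatrix hx hind h3 (by omega)⟩
  have hCirc : IsLittleOInProbability P
      (fun p ω => smallestEigenvalue (sampleCov (circulantMatrix (fun i => x i ω) p (n p))))
      (fun p => Real.exp (-1 * Real.log (p : ℝ) ^ ((1 : ℝ) / 3))) := by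
    refine isLittleOInProbability_of_circulant_columns hC ?_
    filter_upwards [hpn, eventually_two_mul_le hc0 hlim, eventually_gt_atTop 0] with p h1 h2 h3
    exact ⟨n p, h1, by omega, by omega,
      exists_circulant_columns_circulantMatrix hx hind (by omega)⟩
  exact ⟨⟨hT, hCirc⟩, fun α _ => ⟨hT.of_eventually_le eventually_exp_neg_le_log_rpow,
    hCirc.of_eventually_le eventually_exp_neg_le_log_rpow⟩⟩
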